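/- **Quantum query model.** Let $G$ be a finite abelian group and $A:X\to G$ a function on a finite set. A $q$-query quantum algorithm acts on a query register with basis $X$, a response register and a workspace of arbitrary finite dimension. It starts in an arbitrary unit vector, makes $q$ queries to $A$, each followed by an arbitrary unitary that does not depend on $A$, then measures in the computational basis and outputs a function of the result. A query is the unitary $|x,g,z\rangle\mapsto|x,g+A(x),z\rangle$ with $g\in G$ (controlled-add model) or $|x,\xi,z\rangle\mapsto\xi(A(x))\,|x,\xi,z\rangle$ with $\xi$ a character of $G$ (phase model). **Theorem.** Let $\mathbb F$ be a finite field and let $q\ge 1$ and $d$ be integers with $q\le d/2$. Let $A(x)=\sum_{i=0}^d c_i x^i$ with $(c_0,\dots,c_d)$ uniformly random in $\mathbb F^{d+1}$. Then, in either query model, every $q$-query quantum algorithm with access to $A:\mathbb F\to\mathbb F$ outputs $q+1$ pairs $(x_i,A(x_i))$ with pairwise distinct inputs $x_i\in\mathbb F$ with probability at most $$\frac{(q+1)\,q\,e^{2\sqrt q}}{|\mathbb F|},$$ the probability being over the choice of $A$ and the measurement. Consequently, polynomials of degree at most $2q$ are quantum-secure $q$-time message authentication codes (MACs), in the following sense.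 Let $(\mathbb F_n)_{n\in\mathbb N}$ be finite fields, where $n$ is the security parameter, and call a function of $n$ negligible if it is $o(n^{-c})$ for every $c$. The key is a uniformly random coefficient vector of a polynomial $A$ of degree at most $2q$ over $\mathbb F_n$, and the tag of a message $x\in\mathbb F_n$ is $A(x)$. If $q\ge1$ is fixed and $1/|\mathbb F_n|$ is negligible, then every (computationally unbounded) quantum adversary that makes $q$ controlled-add queries to $A$ outputs $q+1$ valid message/tag pairs with distinct messages with only negligible probability. The same holds for $q=q(n)\ge1$ depending on $n$ whenever $(q(n)+1)\,q(n)\,e^{2\sqrt{q(n)}}/|\mathbb F_n|$ is negligible. -/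

import Mathlib

open Filter

noncomputable section

namespace QuantumQuery

/-- Pure states on three registers: a query register with basis `X`, a response register with
basis `Y`, and a workspace of arbitrary finite dimension `w`. -/
abbrev QState (X Y : Type*) [Fintype X] [Fintype Y] (w : ℕ) : Type _ :=
  EuclideanSpace ℂ (X × Y × Fin w)

/-- A quantum algorithm making `q` oracle queries. It starts in an arbitrary unit vector, applies
an arbitrary unitary after each query, finally measures all registers in the computational basis
and outputs a function of the measurement result. -/
structure QueryAlgorithm (X Y : Type*) [Fintype X] [Fintype Y] (q : ℕ) (Out : Type*) where
  /-- dimension of the workspace register -/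
  w : ℕ
  /-- state before the first query -/
  init : QState X Y w
  norm_init : ‖init‖ = 1
  /-- unitary applied after each query -/
  gate : Fin q → (QState X Y w ≃ₗᵢ[ℂ] QState X Y w)
  /-- output computed from the measured basis element -/
  out : X × Y × Fin w → Out

/-- The controlled-add query to `A`: the linear map with `|x, g, z⟩ ↦ |x, g + A x, z⟩`. -/
def addQuery {X G : Type*} [Fintype X] [Fintype G] [AddCommGroup G] (A : X → G) {w : ℕ}
    (ψ : QState X G w) : QState X G w :=
  WithLp.toLp 2 fun b => ψ (b.1, b.2.1 - A b.1, b.2.2)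

/-- The phase query to `A`: the linear map with `|x, ξ, z⟩ ↦ ξ(A x) |x, ξ, z⟩`, where `ξ` ranges
over the characters of `G`. -/
def phaseQuery {X G : Type*} [Fintype X] [Fintype G] [AddCommGroup G] (A : X → G) {w : ℕ}
    (ψ : QState X (AddChar G ℂ) w) : QState X (AddChar G ℂ) w :=
  WithLp.toLp 2 fun b => b.2.1 (A b.1) * ψ b

/-- The state just before the final measurement, when each query is answered by `query`. -/
def QueryAlgorithm.finalState {X Y : Type*} [Fintype X] [Fintype Y] {q : ℕ} {Out : Type*}
    (Q : QueryAlgorithm X Y q Out) (query : QState X Y Q.w → QState X Y Q.w) : QState X Y Q.w :=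
  Fin.foldl q (fun ψ i => Q.gate i (query ψ)) Q.init

open Classical in
/-- Probability (Born rule) that the output of `Q` satisfies `good`, when each query is answered
by `query`. -/
def QueryAlgorithm.prob {X Y : Type*} [Fintype X] [Fintype Y] {q : ℕ} {Out : Type*}
    (Q : QueryAlgorithm X Y q Out) (query : QState X Y Q.w → QState X Y Q.w)
    (good : Out → Prop) : ℝ :=
  ∑ b : X × Y × Fin Q.w, if good (Q.out b) then ‖Q.finalState query b‖ ^ 2 else 0

/-- The list `y` consists of input/output pairs of `A` with pairwise distinct inputs. -/
def CorrectPairs {X G : Type*} {k : ℕ} (A : X → G) (y : Fin k → X × G) : Prop :=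
  Function.Injective (fun i => (y i).1) ∧ ∀ i, A (y i).1 = (y i).2

/-- Probability, over a uniformly random `κ : K` and the measurement, that `Q` with
controlled-add query access to `A κ` outputs `k` correct pairs of `A κ` with distinct inputs. -/
def addSuccess {K X G : Type*} [Fintype K] [Fintype X] [Fintype G] [AddCommGroup G] {q k : ℕ}
    (A : K → X → G) (Q : QueryAlgorithm X G q (Fin k → X × G)) : ℝ :=
  (∑ κ : K, Q.prob (addQuery (A κ)) (CorrectPairs (A κ))) / Fintype.card K

/-- The same probability for an algorithm with phase query access to `A κ`. -/
def phaseSuccess {K X G : Type*} [Fintype K] [Fintype X] [Fintype G] [AddCommGroup G] {q k : ℕ}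
    (A : K → X → G) (Q : QueryAlgorithm X (AddChar G ℂ) q (Fin k → X × G)) : ℝ :=
  (∑ κ : K, Q.prob (phaseQuery (A κ)) (CorrectPairs (A κ))) / Fintype.card K

/-- The function computed by the polynomial of degree at most `d` with coefficients `c`. A random
degree-`d` polynomial is given by uniformly random `c`. -/
def polyFun {F : Type*} [Field F] (d : ℕ) (c : Fin (d + 1) → F) (x : F) : F :=
  (∑ i : Fin (d + 1), Polynomial.monomial (i : ℕ) (c i)).eval x

/-- A function of the security parameter is negligible if it decays faster than every inverse
polynomial. -/
def Negligible (f : ℕ → ℝ) : Prop :=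
  Asymptotics.SuperpolynomialDecay atTop (fun n : ℕ => (n : ℝ)) f

/-- A MAC, given for each security parameter `n` by the tagging function `tag n κ : M n → T n` of
a uniformly random key `κ : K n`, is a quantum-secure `q`-time MAC if every (computationally
unbounded) adversary that makes `q n` quantum queries to the tagging function produces `q n + 1`
valid message/tag pairs with distinct messages with only negligible probability. -/
def IsQuantumSecureMAC (q : ℕ → ℕ) {K M T : ℕ → Type*} [∀ n, Fintype (K n)]
    [∀ n, Fintype (M n)] [∀ n, Fintype (T n)] [∀ n, AddCommGroup (T n)]
    (tag : ∀ n, K n → M n → T n) : Prop :=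
  ∀ Q : ∀ n, QueryAlgorithm (M n) (T n) (q n) (Fin (q n + 1) → M n × T n),
    Negligible fun n => addSuccess (tag n) (Q n)

end QuantumQuery

end

/-!
Each query raises the degree of the amplitudes in the values of `A` by at most one, so after `q`
queries every amplitude is a combination of characters of `X → G` which are nontrivial on at most
`q` coordinates. Fix a measurement outcome, and with it the set `S` of the `q + m` inputs of the
output. The members of the family that agree with the output on `S`, if there are any, form a coset
of the subgroup of those vanishing on `S`, which has index `|G| ^ (q + m)` by interpolation. If
distinct characters had distinct restrictions to this subgroup, then by Parseval the average of the
squared amplitude over the coset would equal its average over all functions, and the latter sum to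
one over the outcomes. In general the number of characters with the same restriction is lost as a
factor. Interpolation on `2q + m` points shows that characters supported on `V`, where `|V| = q`,
with the same restriction are told apart by their values on functions supported on `V ∩ S`, so this
number is at most `∑ V, |G| ^ #(V ∩ S)`. Comparing the sum with its generating function bounds the
success probability by `((1 + √q) / |G|) ^ m * exp (√q * (1 + |X| / |G|))`.
-/

noncomputable section

namespace QuantumQuery

open Finset
open scoped BigOperators ComplexConjugate

section CharacterSums

variable {H : Type*} [AddCommGroup H] [Fintype H]

theorem expect_norm_sq_sum_char (s : Finset (AddChar H ℂ)) (c : AddChar H ℂ → ℂ) :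
    𝔼 h, ‖∑ ψ ∈ s, c ψ * ψ h‖ ^ 2 = ∑ ψ ∈ s, ‖c ψ‖ ^ 2 := by
  classical
  have horth (ψ φ : AddChar H ℂ) : 𝔼 h, ψ h * conj (φ h) = if φ = ψ then 1 else 0 := by
    rw [← AddChar.wInner_cWeight_eq_boole, RCLike.wInner_cWeight_eq_expect]
    rfl
  apply Complex.ofReal_injective
  calc ((𝔼 h, ‖∑ ψ ∈ s, c ψ * ψ h‖ ^ 2 : ℝ) : ℂ)
      = 𝔼 h, ∑ ψ ∈ s, ∑ φ ∈ s, c ψ * conj (c φ) * (ψ h * conj (φ h)) := by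
        push_cast
        simp only [← Complex.mul_conj', map_sum, map_mul, sum_mul_sum, mul_mul_mul_comm]
    _ = ∑ ψ ∈ s, ∑ φ ∈ s, c ψ * conj (c φ) * 𝔼 h, ψ h * conj (φ h) := by
        simp only [expect_sum_comm, mul_expect]
    _ = ((∑ ψ ∈ s, ‖c ψ‖ ^ 2 : ℝ) : ℂ) := by
        push_cast
        simp +contextual [horth, Complex.mul_conj']

open Classical in
theorem expect_norm_sq_sum_char_le {ι : Type*} (s : Finset ι) (a : ι → ℂ) (χ : ι → AddChar H ℂ)
    {T : ℝ} (hT : ∀ ψ, (#{i ∈ s | χ i = ψ} : ℝ) ≤ T) :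
    𝔼 h, ‖∑ i ∈ s, a i * χ i h‖ ^ 2 ≤ T * ∑ i ∈ s, ‖a i‖ ^ 2 := by
  -- Grouping equal characters leads back to Parseval, at the cost of Cauchy–Schwarz on each group.
  have hgroup (h : H) : ∑ i ∈ s, a i * χ i h = ∑ ψ, (∑ i ∈ s with χ i = ψ, a i) * ψ h := by
    rw [← sum_fiberwise s χ]
    refine sum_congr rfl fun ψ _ => ?_
    rw [sum_mul]
    exact sum_congr rfl fun i hi => by rw [(mem_filter.1 hi).2]
  calc 𝔼 h, ‖∑ i ∈ s, a i * χ i h‖ ^ 2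
      = ∑ ψ, ‖∑ i ∈ s with χ i = ψ, a i‖ ^ 2 := by
        simp only [hgroup, expect_norm_sq_sum_char]
    _ ≤ ∑ ψ, T * ∑ i ∈ s with χ i = ψ, ‖a i‖ ^ 2 := by
        gcongr with ψ
        calc ‖∑ i ∈ s with χ i = ψ, a i‖ ^ 2
            ≤ (∑ i ∈ s with χ i = ψ, ‖a i‖) ^ 2 := by gcongr; exact norm_sum_le _ _
          _ ≤ #{i ∈ s | χ i = ψ} * ∑ i ∈ s with χ i = ψ, ‖a i‖ ^ 2 := sq_sum_le_card_mul_sum_sq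
          _ ≤ T * ∑ i ∈ s with χ i = ψ, ‖a i‖ ^ 2 := by gcongr; exact hT ψ
    _ = T * ∑ i ∈ s, ‖a i‖ ^ 2 := by rw [← mul_sum, sum_fiberwise]

end CharacterSums

section Fibers

variable {K L : Type*} [AddGroup K] [Fintype K] [AddGroup L] [Fintype L]

theorem expect_ite_eq_of_surjective {φ : K →+ L} [DecidablePred (· ∈ φ.ker)]
    (hφ : Function.Surjective φ) (κ₀ : K) [DecidablePred fun κ => φ κ = φ κ₀] (u : K → ℝ) :
    𝔼 κ, (if φ κ = φ κ₀ then u κ else 0) = (𝔼 h : φ.ker, u (κ₀ + h)) / Fintype.card L := by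
  have hsum : ∑ κ, (if φ κ = φ κ₀ then u κ else 0) = ∑ h : φ.ker, u (κ₀ + h) := by
    rw [← sum_filter]
    symm
    refine sum_bij (fun h _ => κ₀ + h) (fun h _ => ?_) (fun _ _ _ _ h => by simpa using h)
      (fun κ hκ => ⟨⟨-κ₀ + κ, ?_⟩, mem_univ _, ?_⟩) fun _ _ => rfl
    · simp [φ.mem_ker.1 h.2]
    · simp [AddMonoidHom.mem_ker, (mem_filter.1 hκ).2]
    · simp
  have hcard : (Fintype.card K : ℝ) = Fintype.card φ.ker * Fintype.card L := by
    have := φ.ker.card_mul_index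
    rw [AddSubgroup.index_ker, AddMonoidHom.range_eq_top.2 hφ, AddSubgroup.card_top] at this
    simp only [Nat.card_eq_fintype_card] at this
    exact_mod_cast this.symm
  rw [Fintype.expect_eq_sum_div_card, Fintype.expect_eq_sum_div_card, hsum, hcard, div_div]

end Fibers

section Juntas

variable {X G β : Type*}

/-- A function of `B : X → G` that depends on at most `k` of the values of `B`. -/
def IsJunta (k : ℕ) (f : (X → G) → β) : Prop :=
  ∃ V : Finset X, #V ≤ k ∧ DependsOn f V

/-- The functions of degree at most `k` in `B : X → G`: the combinations of functions depending
on at most `k` values of `B`. The amplitudes after `k` queries are of this kind. -/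
def degreeLE (X G : Type*) (k : ℕ) : Submodule ℂ ((X → G) → ℂ) :=
  Submodule.span ℂ {f | IsJunta k f}

theorem const_mem_degreeLE (c : ℂ) : (fun _ => c) ∈ degreeLE X G 0 :=
  Submodule.subset_span ⟨∅, by simp, by simpa using dependsOn_const c⟩

theorem mul_mem_degreeLE {k : ℕ} {f : (X → G) → ℂ} (hf : f ∈ degreeLE X G k) (x : X)
    (u : G → ℂ) : (fun B => u (B x) * f B) ∈ degreeLE X G (k + 1) := by
  classical
  have hspan : degreeLE X G k ≤
      (degreeLE X G (k + 1)).comap (LinearMap.mulLeft ℂ fun B : X → G => u (B x)) := by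
    refine Submodule.span_le.2 ?_
    rintro g ⟨V, hV, hg⟩
    refine Submodule.subset_span ⟨insert x V, (card_insert_le x V).trans (by lia), fun B C h => ?_⟩
    simp only [LinearMap.mulLeft_apply, Pi.mul_apply]
    rw [h x (by simp), hg fun y hy => h y (by simp_all)]
  exact hspan hf

section Characters

variable [AddCommGroup G] [Fintype X] [Fintype G]

open Classical in
/-- The characters of `X → G` of Hamming weight at most `k`, that is, those which are trivial on
all but at most `k` coordinates. -/
def lowWeightChars (X G : Type*) [AddCommGroup G] [Fintype X] [Fintype G] (k : ℕ) :
    Finset (AddChar (X → G) ℂ) :=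
  univ.filter fun ψ => IsJunta k ψ

theorem mem_lowWeightChars {k : ℕ} {ψ : AddChar (X → G) ℂ} :
    ψ ∈ lowWeightChars X G k ↔ IsJunta k ψ := by
  simp [lowWeightChars]

theorem degreeLE_le_span_lowWeightChars (k : ℕ) : degreeLE X G k ≤ Submodule.span ℂ
    ((fun (ψ : AddChar (X → G) ℂ) B => ψ B) '' (lowWeightChars X G k : Set _)) := by
  refine Submodule.span_le.2 ?_
  rintro g ⟨V, hV, hg⟩
  let extend : (V → G) →+ (X → G) := Function.ExtendByZero.hom G Subtype.val
  let restrict : (X → G) →+ (V → G) := AddMonoidHom.pi fun x => Pi.evalAddMonoidHom _ x.1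
  have hgV : g = ∑ ψ, (AddChar.complexBasis (V → G)).repr (g ∘ extend) ψ •
      fun B => ψ.compAddMonoidHom restrict B := by
    ext B
    have hB : g B = g (extend (restrict B)) := hg fun x hx =>
      (Function.extend_val_apply (g := restrict B) (j := 0) hx).symm
    have hsum := congrFun ((AddChar.complexBasis (V → G)).sum_repr (g ∘ extend)) (restrict B)
    simp only [AddChar.complexBasis_apply, Finset.sum_apply, Pi.smul_apply,
      Function.comp_apply] at hsum
    simp only [Finset.sum_apply, Pi.smul_apply, AddChar.compAddMonoidHom_apply, hB, hsum]
  rw [hgV]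
  refine Submodule.sum_mem _ fun ψ _ => Submodule.smul_mem _ _ (Submodule.subset_span
    ⟨ψ.compAddMonoidHom restrict, mem_lowWeightChars.2 ⟨V, hV, fun B C h => congrArg ψ ?_⟩, rfl⟩)
  ext x
  exact h x x.2

theorem exists_eq_sum_lowWeightChars {k : ℕ} {f : (X → G) → ℂ} (hf : f ∈ degreeLE X G k) :
    ∃ a : AddChar (X → G) ℂ → ℂ, ∀ B, f B = ∑ ψ ∈ lowWeightChars X G k, a ψ * ψ B := by
  obtain ⟨a, rfl⟩ := (Submodule.mem_span_image_finset_iff_exists_fun' ℂ).1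
    (degreeLE_le_span_lowWeightChars k hf)
  exact ⟨a, fun B => by simp⟩

end Characters

end Juntas

section Interpolation

variable {K X G : Type*}

/-- Every prescription of values on at most `k` points is met by some member of the family `A`. -/
def Interpolates (A : K → X → G) (k : ℕ) : Prop :=
  ∀ S : Finset X, #S ≤ k → Function.Surjective fun κ => S.restrict (A κ)

variable [AddCommGroup G]

/-- The values on `S` of the members of an additive family of functions. -/
def restrictHom [AddZeroClass K] (A : K →+ (X → G)) (S : Finset X) : K →+ (S → G) :=
  (AddMonoidHom.pi fun x => Pi.evalAddMonoidHom _ x.1).comp A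

theorem restrictHom_eq_iff [AddZeroClass K] {A : K →+ (X → G)} {S : Finset X} {κ κ' : K} :
    restrictHom A S κ = restrictHom A S κ' ↔ ∀ x ∈ S, A κ x = A κ' x :=
  funext_iff.trans Subtype.forall

/-- The inclusion of the members of an additive family which vanish on `S` into all functions. -/
abbrev vanishingHom [AddGroup K] (A : K →+ (X → G)) (S : Finset X) :
    (restrictHom A S).ker →+ (X → G) :=
  A.comp (restrictHom A S).ker.subtype

theorem eq_of_dependsOn_of_eq_on_vanishing [DecidableEq X] {R : Type*} [Monoid R]
    {A : K → X → G} {S V : Finset X} (hA : Interpolates A #(V ∪ S)) {ψ ψ' : AddChar (X → G) R}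
    (hψ : DependsOn ψ V) (hψ' : DependsOn ψ' V)
    (hvanishing : ∀ κ, (∀ x ∈ S, A κ x = 0) → ψ (A κ) = ψ' (A κ))
    (hinter : ∀ B, (∀ x ∉ V ∩ S, B x = 0) → ψ B = ψ' B) : ψ = ψ' := by
  ext B
  -- On `V`, `B` is the sum of a member of `A` vanishing on `S` and a function supported on `V ∩ S`.
  obtain ⟨κ, hκ⟩ := hA _ le_rfl ((V ∪ S).restrict fun x => if x ∈ S then 0 else B x)
  have hκ (x) (hx : x ∈ V ∪ S) : A κ x = if x ∈ S then 0 else B x := congrFun hκ ⟨x, hx⟩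
  let C : X → G := fun x => if x ∈ V ∩ S then B x else 0
  have hB (x) (hx : x ∈ V) : B x = (A κ + C) x := by
    by_cases hxS : x ∈ S <;> simp [C, hκ x (mem_union_left _ hx), hx, hxS]
  have hS (x) (hx : x ∈ S) : A κ x = 0 := by rw [hκ x (mem_union_right _ hx), if_pos hx]
  rw [hψ hB, hψ' hB, AddChar.map_add_eq_mul, AddChar.map_add_eq_mul, hvanishing κ hS,
    hinter C fun x hx => if_neg hx]

variable [Fintype G] [AddCommGroup K]

open Classical in
theorem card_dependsOn_fiber_le [Finite X] {A : K →+ (X → G)} {S V : Finset X}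
    (hA : Interpolates A #(V ∪ S)) (χ : AddChar (restrictHom A S).ker ℂ) :
    #{ψ : AddChar (X → G) ℂ | DependsOn ψ (V : Set X) ∧
      ψ.compAddMonoidHom (vanishingHom A S) = χ} ≤
      Fintype.card G ^ #(V ∩ S) := by
  let extend : (↥(V ∩ S) → G) →+ (X → G) := Function.ExtendByZero.hom G Subtype.val
  have hextend {B : X → G} (hB : ∀ x ∉ V ∩ S, B x = 0) : extend ((V ∩ S).restrict B) = B := by
    ext x
    by_cases hx : x ∈ V ∩ S
    · exact Function.extend_val_apply hx
    · exact (Function.extend_val_apply' hx).trans (hB x hx).symm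
  calc _ ≤ #(univ : Finset (AddChar (↥(V ∩ S) → G) ℂ)) := by
        refine card_le_card_of_injOn (fun ψ => ψ.compAddMonoidHom extend) (by simp [Set.MapsTo])
          fun ψ hψ ψ' hψ' h => ?_
        obtain ⟨hψV, hψχ⟩ := (mem_filter.1 hψ).2
        obtain ⟨hψ'V, hψ'χ⟩ := (mem_filter.1 hψ').2
        refine eq_of_dependsOn_of_eq_on_vanishing hA hψV hψ'V (fun κ hκ => ?_) fun B hB => ?_
        · exact DFunLike.congr_fun (hψχ.trans hψ'χ.symm)
            (⟨κ, by ext x; exact hκ x x.2⟩ : (restrictHom A S).ker)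
        · rw [← hextend hB]
          exact DFunLike.congr_fun h _
    _ = Fintype.card G ^ #(V ∩ S) := by simp

variable [Fintype X]

open Classical in
/-- A bound for the number of characters of weight at most `q` with a given restriction to the
members of an interpolating family which vanish on `S`. -/
def collisionBound (S : Finset X) (q M : ℕ) : ℕ :=
  ∑ V ∈ powersetCard q univ, M ^ #(V ∩ S)

open Classical in
theorem card_lowWeightChars_fiber_le {A : K →+ (X → G)} {q : ℕ} {S : Finset X}
    (hq : q ≤ Fintype.card X) (hA : Interpolates A (q + #S)) (χ : AddChar (restrictHom A S).ker ℂ) :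
    #{ψ ∈ lowWeightChars X G q | ψ.compAddMonoidHom (vanishingHom A S) = χ} ≤
      collisionBound S q (Fintype.card G) := by
  have hsub : {ψ ∈ lowWeightChars X G q | ψ.compAddMonoidHom (vanishingHom A S) = χ} ⊆
      (powersetCard q univ).biUnion fun V : Finset X => {ψ | DependsOn ψ (V : Set X) ∧
        ψ.compAddMonoidHom (vanishingHom A S) = χ} := by
    intro ψ hψ
    obtain ⟨hψq, hψχ⟩ := mem_filter.1 hψ
    obtain ⟨U, hU, hψU⟩ := mem_lowWeightChars.1 hψq
    obtain ⟨V, hUV, -, hV⟩ := exists_subsuperset_card_eq (subset_univ U) hU hq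
    simp only [mem_biUnion, mem_filter, mem_univ, true_and, mem_powersetCard_univ]
    exact ⟨V, hV, hψU.mono (coe_subset.2 hUV), hψχ⟩
  refine (card_le_card hsub).trans (card_biUnion_le.trans (sum_le_sum fun V hV => ?_))
  refine card_dependsOn_fiber_le (fun U hU => hA U (hU.trans ?_)) χ
  rw [← mem_powersetCard_univ.1 hV]
  exact card_union_le V S

open Classical in
theorem expect_norm_sq_agree_le [Fintype K] {A : K →+ (X → G)} {q : ℕ} {S : Finset X}
    (hq : q ≤ Fintype.card X) (hA : Interpolates A (q + #S)) {f : (X → G) → ℂ}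
    (hf : f ∈ degreeLE X G q) (κ₀ : K) :
    𝔼 κ, (if ∀ x ∈ S, A κ x = A κ₀ x then ‖f (A κ)‖ ^ 2 else 0) ≤
      collisionBound S q (Fintype.card G) / (Fintype.card G : ℝ) ^ #S * 𝔼 B, ‖f B‖ ^ 2 := by
  obtain ⟨a, ha⟩ := exists_eq_sum_lowWeightChars hf
  have hcoset (h : (restrictHom A S).ker) : f (A (κ₀ + h)) = ∑ ψ ∈ lowWeightChars X G q,
      a ψ * ψ (A κ₀) * ψ.compAddMonoidHom (vanishingHom A S) h := by
    simp only [ha, map_add, AddChar.map_add_eq_mul, mul_assoc, AddChar.compAddMonoidHom_apply,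
      AddMonoidHom.comp_apply, AddSubgroup.coe_subtype]
  calc 𝔼 κ, (if ∀ x ∈ S, A κ x = A κ₀ x then ‖f (A κ)‖ ^ 2 else 0)
      = (𝔼 h : (restrictHom A S).ker, ‖f (A (κ₀ + h))‖ ^ 2) / (Fintype.card G : ℝ) ^ #S := by
        simp only [← restrictHom_eq_iff]
        rw [expect_ite_eq_of_surjective (hA S (by lia)) κ₀]
        simp
    _ ≤ (collisionBound S q (Fintype.card G) * ∑ ψ ∈ lowWeightChars X G q, ‖a ψ‖ ^ 2) /
        (Fintype.card G : ℝ) ^ #S := by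
        simp only [hcoset]
        gcongr
        simpa using expect_norm_sq_sum_char_le (lowWeightChars X G q) (fun ψ => a ψ * ψ (A κ₀)) _
          fun χ => Nat.cast_le.2 (card_lowWeightChars_fiber_le hq hA χ)
    _ = collisionBound S q (Fintype.card G) / (Fintype.card G : ℝ) ^ #S * 𝔼 B, ‖f B‖ ^ 2 := by
        simp only [ha, expect_norm_sq_sum_char]
        ring

end Interpolation

section Numerics

open Classical in
theorem pow_mul_sum_powersetCard_le {X : Type*} [Fintype X] (S : Finset X) (q : ℕ) {t w : ℝ}
    (ht : 0 ≤ t) (hw : 0 ≤ w) :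
    t ^ q * ∑ V ∈ powersetCard q univ, w ^ #(V ∩ S) ≤ (1 + t) ^ #Sᶜ * (1 + t * w) ^ #S := by
  calc t ^ q * ∑ V ∈ powersetCard q univ, w ^ #(V ∩ S)
      = ∑ V ∈ powersetCard q univ, ∏ x ∈ V, t * (if x ∈ S then w else 1) := by
        rw [mul_sum]
        refine sum_congr rfl fun V hV => ?_
        rw [prod_mul_distrib, prod_const, mem_powersetCard_univ.1 hV, prod_ite_mem, prod_const]
    _ ≤ ∑ V ∈ univ.powerset, ∏ x ∈ V, t * (if x ∈ S then w else 1) := by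
        refine sum_le_sum_of_subset_of_nonneg (by simp) fun V _ _ => prod_nonneg fun x _ => ?_
        positivity
    _ = ∏ x, (1 + t * if x ∈ S then w else 1) := (prod_one_add univ).symm
    _ = (1 + t) ^ #Sᶜ * (1 + t * w) ^ #S := by
        rw [← prod_mul_prod_compl S, mul_comm]
        congr 1
        · rw [← prod_const]
          exact prod_congr rfl fun x hx => by rw [if_neg (mem_compl.1 hx), mul_one]
        · rw [← prod_const]
          exact prod_congr rfl fun x hx => by rw [if_pos hx]

theorem one_add_sqrt_pow_le (q : ℕ) : (1 + √q) ^ q ≤ √q ^ q * Real.exp √q := by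
  obtain rfl | hq := q.eq_zero_or_pos
  · simp
  have hsqrt : 0 < √(q : ℝ) := by positivity
  calc (1 + √q) ^ q = √q ^ q * (1 + (√q)⁻¹) ^ q := by
        rw [← mul_pow, mul_add, mul_one, mul_inv_cancel₀ hsqrt.ne', add_comm]
    _ ≤ √q ^ q * Real.exp (√q)⁻¹ ^ q := by
        gcongr
        rw [add_comm]
        exact Real.add_one_le_exp _
    _ = √q ^ q * Real.exp √q := by
        rw [← Real.exp_nat_mul, ← div_eq_mul_inv, Real.div_sqrt]

/-- Upper bound for the probability of finding, with `q` queries, `q + m` values of a random member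
of an interpolating family of functions from `N` points to a group of order `M`. -/
def successBound (q m : ℕ) (N M : ℕ) : ℝ :=
  ((1 + √q) / M) ^ m * Real.exp (√q * (1 + N / M))

theorem collisionBound_div_le {X : Type*} [Fintype X] {S : Finset X} {q m M : ℕ} (hM : 0 < M)
    (hS : #S = q + m) :
    collisionBound S q M / (M : ℝ) ^ #S ≤ successBound q m (Fintype.card X) M := by
  classical
  have hM' : (0 : ℝ) < M := by exact_mod_cast hM
  have hsqrt : 0 < √(q : ℝ) ^ q := by
    obtain rfl | hq := q.eq_zero_or_pos <;> [simp; positivity]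
  -- `t = √q / M` is the value for which the two exponential factors below are both about `exp √q`.
  have hgen : (√q / M) ^ q * collisionBound S q M ≤
      (1 + √q / M) ^ #Sᶜ * (1 + √q) ^ (q + m) := by
    have h := pow_mul_sum_powersetCard_le S q (t := √q / M) (w := M) (by positivity) hM'.le
    rw [div_mul_cancel₀ _ hM'.ne', hS] at h
    simpa [collisionBound] using h
  have hexp : (1 + √q / M) ^ #Sᶜ ≤ Real.exp (√q * (Fintype.card X / M)) := by
    calc (1 + √q / M) ^ #Sᶜ ≤ (1 + √q / M) ^ Fintype.card X :=
          pow_le_pow_right₀ (le_add_of_nonneg_right (by positivity)) (card_le_univ _)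
      _ ≤ Real.exp (√q / M) ^ Fintype.card X := by
          gcongr
          rw [add_comm]
          exact Real.add_one_le_exp _
      _ = Real.exp (√q * (Fintype.card X / M)) := by
          rw [← Real.exp_nat_mul]
          ring_nf
  calc collisionBound S q M / (M : ℝ) ^ #S
      = (√q / M) ^ q * collisionBound S q M / (√q ^ q * M ^ m) := by
        rw [hS, div_pow]
        field_simp
        ring
    _ ≤ Real.exp (√q * (Fintype.card X / M)) * (√q ^ q * Real.exp √q * (1 + √q) ^ m) /
        (√q ^ q * M ^ m) := by
        refine div_le_div_of_nonneg_right (hgen.trans ?_) (by positivity)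
        rw [pow_add]
        gcongr
        exact one_add_sqrt_pow_le q
    _ = successBound q m (Fintype.card X) M := by
        rw [successBound, mul_add, mul_one, Real.exp_add, div_pow]
        field_simp

end Numerics

section Amplitudes

variable {X Y G : Type*} [Fintype X] [Fintype Y]

/-- The amplitudes of the state `ψ B` have degree at most `k` in `B`. -/
def StateDegreeLE {w : ℕ} (k : ℕ) (ψ : (X → G) → QState X Y w) : Prop :=
  ∀ b, (fun B => ψ B b) ∈ degreeLE X G k

theorem StateDegreeLE.gate {w k : ℕ} {ψ : (X → G) → QState X Y w} (hψ : StateDegreeLE k ψ)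
    (U : QState X Y w ≃ₗᵢ[ℂ] QState X Y w) : StateDegreeLE k fun B => U (ψ B) := by
  classical
  intro b
  have hU : (fun B => U (ψ B) b) = ∑ b', U (EuclideanSpace.single b' 1) b • fun B => ψ B b' := by
    ext B
    nth_rw 1 [← (EuclideanSpace.basisFun (X × Y × Fin w) ℂ).sum_repr (ψ B)]
    simp [mul_comm]
  rw [hU]
  exact Submodule.sum_mem _ fun b' _ => Submodule.smul_mem _ _ (hψ b')

/-- A query preserves norms and raises the degree of the amplitudes by at most one. These are the
only properties of the two query models on which the bounds depend. -/
structure IsQuery {w : ℕ} (query : (X → G) → QState X Y w → QState X Y w) : Prop where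
  norm_eq : ∀ B ψ, ‖query B ψ‖ = ‖ψ‖
  degree_le : ∀ {k : ℕ} {ψ : (X → G) → QState X Y w}, StateDegreeLE k ψ →
    StateDegreeLE (k + 1) fun B => query B (ψ B)

theorem isQuery_addQuery [Fintype G] [AddCommGroup G] {w : ℕ} :
    IsQuery fun (B : X → G) (ψ : QState X G w) => addQuery B ψ where
  norm_eq B ψ := by
    simp only [EuclideanSpace.norm_eq, addQuery, Fintype.sum_prod_type]
    congr! 2 with x
    exact (Equiv.subRight (B x)).sum_comp fun g => ∑ z, ‖ψ (x, g, z)‖ ^ 2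
  degree_le {k ψ} hψ b := by
    classical
    have hsum : (fun B => addQuery B (ψ B) b) =
        ∑ h, fun B => (if B b.1 = h then (1 : ℂ) else 0) * ψ B (b.1, b.2.1 - h, b.2.2) := by
      ext B
      simp [addQuery]
    rw [hsum]
    exact Submodule.sum_mem _ fun h _ => mul_mem_degreeLE (hψ _) b.1 fun g => if g = h then 1 else 0

theorem isQuery_phaseQuery [Fintype G] [AddCommGroup G] {w : ℕ} :
    IsQuery fun (B : X → G) (ψ : QState X (AddChar G ℂ) w) => phaseQuery B ψ where
  norm_eq B ψ := by simp [EuclideanSpace.norm_eq, phaseQuery]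
  degree_le hψ b := mul_mem_degreeLE (hψ b) b.1 b.2.1

variable {q : ℕ} {Out : Type*} (Q : QueryAlgorithm X Y q Out)
  {query : (X → G) → QState X Y Q.w → QState X Y Q.w}

theorem norm_finalState (hquery : IsQuery query) (B : X → G) : ‖Q.finalState (query B)‖ = 1 := by
  suffices h : ∀ (n : ℕ) (gate : Fin n → (QState X Y Q.w ≃ₗᵢ[ℂ] QState X Y Q.w)),
      ‖Fin.foldl n (fun ψ i => gate i (query B ψ)) Q.init‖ = 1 from h q Q.gate
  intro n gate
  induction n with
  | zero => simpa using Q.norm_init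
  | succ n ih =>
    rw [Fin.foldl_succ_last, LinearIsometryEquiv.norm_map, hquery.norm_eq]
    exact ih _

theorem stateDegreeLE_finalState (hquery : IsQuery query) :
    StateDegreeLE q fun B => Q.finalState (query B) := by
  suffices h : ∀ (n : ℕ) (gate : Fin n → (QState X Y Q.w ≃ₗᵢ[ℂ] QState X Y Q.w)),
      StateDegreeLE n fun B => Fin.foldl n (fun ψ i => gate i (query B ψ)) Q.init from h q Q.gate
  intro n gate
  induction n with
  | zero => exact fun b => by simpa using const_mem_degreeLE (Q.init b)
  | succ n ih =>
    simp only [Fin.foldl_succ_last]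
    exact (hquery.degree_le (ih _)).gate _

end Amplitudes

section Success

variable {K X Y G : Type*} [Fintype K] [AddCommGroup K] [Fintype X] [Fintype Y] [Fintype G]
  [AddCommGroup G] {A : K →+ (X → G)} {q m : ℕ}

open Classical in
theorem expect_correct_le (hA : Interpolates A (2 * q + m)) {f : (X → G) → ℂ}
    (hf : f ∈ degreeLE X G q) (y : Fin (q + m) → X × G) :
    𝔼 κ, (if CorrectPairs (A κ) y then ‖f (A κ)‖ ^ 2 else 0) ≤
      successBound q m (Fintype.card X) (Fintype.card G) * 𝔼 B, ‖f B‖ ^ 2 := by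
  by_cases hy : ∃ κ₀, CorrectPairs (A κ₀) y
  · obtain ⟨κ₀, hinj, hκ₀⟩ := hy
    let S := univ.image fun i => (y i).1
    have hS : #S = q + m := by simp [S, card_image_of_injective _ hinj]
    have hagree (κ : K) : CorrectPairs (A κ) y ↔ ∀ x ∈ S, A κ x = A κ₀ x := by
      simp [CorrectPairs, hinj, S, hκ₀]
    simp only [hagree]
    have hq : q ≤ Fintype.card X := (Nat.le_add_right q m).trans (hS ▸ card_le_univ S)
    refine (expect_norm_sq_agree_le hq (fun U hU => hA U (by lia)) hf κ₀).trans ?_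
    gcongr
    exact collisionBound_div_le Fintype.card_pos hS
  · simp only [not_exists.1 hy, if_false, expect_const_zero]
    rw [successBound]
    positivity

theorem expect_prob_correct_le (hA : Interpolates A (2 * q + m))
    (Q : QueryAlgorithm X Y q (Fin (q + m) → X × G))
    {query : (X → G) → QState X Y Q.w → QState X Y Q.w} (hquery : IsQuery query) :
    𝔼 κ, Q.prob (query (A κ)) (CorrectPairs (A κ)) ≤
      successBound q m (Fintype.card X) (Fintype.card G) := by
  classical
  have hnorm : ∑ b, 𝔼 B, ‖Q.finalState (query B) b‖ ^ 2 = 1 := by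
    rw [← expect_sum_comm]
    simp [← EuclideanSpace.norm_sq_eq, norm_finalState Q hquery]
  calc 𝔼 κ, Q.prob (query (A κ)) (CorrectPairs (A κ))
      ≤ ∑ b, successBound q m (Fintype.card X) (Fintype.card G) *
          𝔼 B, ‖Q.finalState (query B) b‖ ^ 2 := by
        simp only [QueryAlgorithm.prob, expect_sum_comm]
        gcongr with b
        convert expect_correct_le hA (stateDegreeLE_finalState Q hquery b) (Q.out b)
    _ = successBound q m (Fintype.card X) (Fintype.card G) := by rw [← mul_sum, hnorm, mul_one]

theorem addSuccess_le (hA : Interpolates A (2 * q + m))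
    (Q : QueryAlgorithm X G q (Fin (q + m) → X × G)) :
    addSuccess A Q ≤ successBound q m (Fintype.card X) (Fintype.card G) := by
  rw [addSuccess, ← Fintype.expect_eq_sum_div_card]
  exact expect_prob_correct_le hA Q (query := fun B ψ => addQuery B ψ) isQuery_addQuery

theorem phaseSuccess_le (hA : Interpolates A (2 * q + m))
    (Q : QueryAlgorithm X (AddChar G ℂ) q (Fin (q + m) → X × G)) :
    phaseSuccess A Q ≤ successBound q m (Fintype.card X) (Fintype.card G) := by
  rw [phaseSuccess, ← Fintype.expect_eq_sum_div_card]
  exact expect_prob_correct_le hA Q (query := fun B ψ => phaseQuery B ψ) isQuery_phaseQuery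

end Success

section Security

theorem addSuccess_nonneg {K X G : Type*} [Fintype K] [Fintype X] [Fintype G] [AddCommGroup G]
    {q k : ℕ} (A : K → X → G) (Q : QueryAlgorithm X G q (Fin k → X × G)) :
    0 ≤ addSuccess A Q := by
  refine div_nonneg (sum_nonneg fun κ _ => sum_nonneg fun b _ => ?_) (Nat.cast_nonneg _)
  split_ifs <;> positivity

theorem Negligible.mono {f g : ℕ → ℝ} (hf : Negligible f) (hg : ∀ n, 0 ≤ g n)
    (hgf : ∀ n, g n ≤ f n) : Negligible g :=
  Asymptotics.SuperpolynomialDecay.trans_abs_le hf fun n =>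
    abs_le_abs_of_nonneg (hg n) (hgf n)

theorem isQuantumSecureMAC_of_interpolates {K M T : ℕ → Type*} [∀ n, AddCommGroup (K n)]
    [∀ n, Fintype (K n)] [∀ n, Fintype (M n)] [∀ n, Fintype (T n)] [∀ n, AddCommGroup (T n)]
    {A : ∀ n, K n →+ (M n → T n)} {q : ℕ → ℕ} (hA : ∀ n, Interpolates (A n) (2 * q n + 1))
    (h : Negligible fun n => successBound (q n) 1 (Fintype.card (M n)) (Fintype.card (T n))) :
    IsQuantumSecureMAC q fun n => A n :=
  fun Q => h.mono (fun n => addSuccess_nonneg _ (Q n)) fun n => addSuccess_le (hA n) (Q n)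

end Security

section Polynomials

variable {F : Type*} [Field F]

/-- The map `polyFun` from coefficients to functions, as a homomorphism. -/
def polyFunHom (F : Type*) [Field F] (d : ℕ) : (Fin (d + 1) → F) →+ (F → F) where
  toFun := polyFun d
  map_zero' := by ext; simp [polyFun]
  map_add' c c' := by ext; simp [polyFun, sum_add_distrib]

theorem polyFun_coeff {d : ℕ} {p : Polynomial F} (hp : p.degree < ↑(d + 1)) (x : F) :
    polyFun d (fun i => p.coeff i) x = p.eval x := by
  rw [polyFun, p.sum_fin (fun i => Polynomial.monomial i) (by simp) hp, p.sum_monomial_eq]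

theorem interpolates_polyFunHom {d k : ℕ} (hk : k ≤ d + 1) : Interpolates (polyFunHom F d) k := by
  classical
  intro S hS y
  let values : F → F := Function.extend Subtype.val y 0
  let p := Lagrange.interpolate S id values
  have hp : p.degree < ↑(d + 1) := (Lagrange.degree_interpolate_lt _
    Function.injective_id.injOn).trans_le (by exact_mod_cast hS.trans hk)
  refine ⟨fun i => p.coeff i, funext fun x => ?_⟩
  calc polyFun d (fun i => p.coeff i) x = p.eval (id (x : F)) := polyFun_coeff hp x
    _ = values x := Lagrange.eval_interpolate_at_node _ Function.injective_id.injOn x.2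
    _ = y x := Subtype.val_injective.extend_apply y 0 x

end Polynomials

section PaperBound

theorem successBound_one_le {q : ℕ} (hq : 1 ≤ q) (N : ℕ) :
    successBound q 1 N N ≤ ((q : ℝ) + 1) * q * Real.exp (2 * √(q : ℝ)) / N := by
  have hq' : (1 : ℝ) ≤ q := by exact_mod_cast hq
  have hsqrt : 1 + √q ≤ ((q : ℝ) + 1) * q := by
    nlinarith [Real.sqrt_le_self_iff.2 (Or.inr hq')]
  calc successBound q 1 N N = (1 + √q) / N * Real.exp (√q * (1 + N / N)) := by
        rw [successBound, pow_one]
    _ ≤ ((q : ℝ) + 1) * q / N * Real.exp (√q * (1 + 1)) := by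
        gcongr
        exact div_self_le_one _
    _ = ((q : ℝ) + 1) * q * Real.exp (2 * √(q : ℝ)) / N := by ring_nf

theorem negligible_successBound {q N : ℕ → ℕ} (hq : ∀ n, 1 ≤ q n)
    (h : Negligible fun n => ((q n : ℝ) + 1) * q n * Real.exp (2 * √(q n : ℝ)) / N n) :
    Negligible fun n => successBound (q n) 1 (N n) (N n) :=
  h.mono (fun n => by rw [successBound]; positivity) fun n => successBound_one_le (hq n) (N n)

end PaperBound

end QuantumQuery

end

theorem theorem5p4_general.{u, v, w} :
    (∀ (K : Type u) (X : Type v) (G : Type w) [AddCommGroup K] [Fintype K]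
      [Fintype X] [AddCommGroup G] [Fintype G] (A : K →+ (X → G)) (q m : ℕ),
      QuantumQuery.Interpolates A (2 * q + m) →
      (∀ Q : QuantumQuery.QueryAlgorithm X G q (Fin (q + m) → X × G),
        QuantumQuery.addSuccess A Q ≤
          QuantumQuery.successBound q m (Fintype.card X) (Fintype.card G)) ∧
      (∀ Q : QuantumQuery.QueryAlgorithm X (AddChar G ℂ) q (Fin (q + m) → X × G),
        QuantumQuery.phaseSuccess A Q ≤
          QuantumQuery.successBound q m (Fintype.card X) (Fintype.card G))) ∧
    (∀ (K : ℕ → Type u) (M : ℕ → Type v) (T : ℕ → Type w) [∀ n, AddCommGroup (K n)]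
      [∀ n, Fintype (K n)] [∀ n, Fintype (M n)] [∀ n, AddCommGroup (T n)] [∀ n, Fintype (T n)]
      (A : ∀ n, K n →+ (M n → T n)) (q : ℕ → ℕ),
      (∀ n, QuantumQuery.Interpolates (A n) (2 * q n + 1)) →
      QuantumQuery.Negligible (fun n =>
        QuantumQuery.successBound (q n) 1 (Fintype.card (M n)) (Fintype.card (T n))) →
      QuantumQuery.IsQuantumSecureMAC q (fun n => A n)) :=
  ⟨fun _ _ _ _ _ _ _ _ _ _ _ hA =>
      ⟨QuantumQuery.addSuccess_le hA, QuantumQuery.phaseSuccess_le hA⟩,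
    fun _ _ _ _ _ _ _ _ _ _ => QuantumQuery.isQuantumSecureMAC_of_interpolates⟩

theorem theorem5p4 :
    -- the success bound, in the controlled-add and in the phase query model
    (∀ (F : Type*) [Field F] [Fintype F] (q d : ℕ), 1 ≤ q → (q : ℝ) ≤ (d : ℝ) / 2 →
      (∀ Q : QuantumQuery.QueryAlgorithm F F q (Fin (q + 1) → F × F),
        QuantumQuery.addSuccess (QuantumQuery.polyFun (F := F) d) Q ≤
          ((q : ℝ) + 1) * q * Real.exp (2 * √(q : ℝ)) / Fintype.card F) ∧
      (∀ Q : QuantumQuery.QueryAlgorithm F (AddChar F ℂ) q (Fin (q + 1) → F × F),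
        QuantumQuery.phaseSuccess (QuantumQuery.polyFun (F := F) d) Q ≤
          ((q : ℝ) + 1) * q * Real.exp (2 * √(q : ℝ)) / Fintype.card F)) ∧
    -- degree-`2q` polynomials are quantum-secure `q`-time MACs: fixed `q`
    (∀ (F : ℕ → Type*) [∀ n, Field (F n)] [∀ n, Fintype (F n)] (q : ℕ), 1 ≤ q →
      QuantumQuery.Negligible (fun n => 1 / (Fintype.card (F n) : ℝ)) →
      QuantumQuery.IsQuantumSecureMAC (fun _ => q)
        (fun n => QuantumQuery.polyFun (F := F n) (2 * q))) ∧
    -- the same for `q` growing with the security parameter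
    (∀ (F : ℕ → Type*) [∀ n, Field (F n)] [∀ n, Fintype (F n)] (q : ℕ → ℕ), (∀ n, 1 ≤ q n) →
      QuantumQuery.Negligible (fun n =>
        ((q n : ℝ) + 1) * q n * Real.exp (2 * √(q n : ℝ)) / Fintype.card (F n)) →
      QuantumQuery.IsQuantumSecureMAC q
        (fun n => QuantumQuery.polyFun (F := F n) (2 * q n))) := by
  refine ⟨fun F _ _ q d hq hqd => ?_, fun F _ _ q hq h => ?_, fun F _ _ q hq h => ?_⟩
  · have hA : QuantumQuery.Interpolates (QuantumQuery.polyFunHom F d) (2 * q + 1) :=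
      QuantumQuery.interpolates_polyFunHom (Nat.succ_le_succ (by rify; linarith))
    have hbound := theorem5p4_general.1 _ _ _ _ q 1 hA
    exact ⟨fun Q => (hbound.1 Q).trans (QuantumQuery.successBound_one_le hq _),
      fun Q => (hbound.2 Q).trans (QuantumQuery.successBound_one_le hq _)⟩
  · refine theorem5p4_general.2 _ _ _ (fun n => QuantumQuery.polyFunHom (F n) (2 * q)) _
      (fun _ => QuantumQuery.interpolates_polyFunHom le_rfl)
      (QuantumQuery.negligible_successBound (fun _ => hq) ?_)
    exact (h.const_mul _).congr fun _ => mul_one_div _ _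
  · exact theorem5p4_general.2 _ _ _ (fun n => QuantumQuery.polyFunHom (F n) (2 * q n)) _
      (fun _ => QuantumQuery.interpolates_polyFunHom le_rfl)
      (QuantumQuery.negligible_successBound hq h)
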